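/- Let $p\ge 3$ be a prime, let $\mathbb{C}_p$ be the completion of an algebraic closure of $\mathbb{Q}_p$ with $|p|=1/p$, and let $\lambda\in\mathbb{C}_p$ be not a root of unity, with $1/p<|1-\lambda|<1$. Put $P_\lambda(x)=\lambda x+x^2$. The linearization disk of $P_\lambda$ is the largest disk $D$ (open or closed, of positive radius) about the origin on which $P_\lambda$ is analytically conjugate to $x\mapsto\lambda x$, i.e. such that $P_\lambda(D)\subseteq D$ and there is a power series $H$ over $\mathbb{C}_p$ that converges on $D$, maps $D$ bijectively onto a disk about the origin, and satisfies $H(P_\lambda(x))=\lambda H(x)$ for all $x\in D$. Put $R(0)=0$ and $R(j)=p^{-1/(p^{j-1}(p-1))}$ for integers $j\ge1$. Let $m\ge 1$ be the least integer with $|1-\lambda^m|<1$ (so $m=1$ here); let $s\ge0$ be the integer with $R(s)\le|1-\lambda^m|<R(s+1)$; let $\gamma_0$ be a root of unity of $p$-power order minimizing $|\gamma_0-\lambda^m|$ among all roots of unity of $p$-power order in $\mathbb{C}_p$; let $t\ge0$ be the integer with $R(t)\le|\gamma_0-\lambda^m|<R(t+1)$; and put $$\tilde r(\lambda)=R(s+1)^{\frac1m}\,p^{-\frac{s-t}{mp^s}}\,|1-\lambda^m|^{s\frac{p-1}{mp}}\,|\gamma_0-\lambda^m|^{\frac{1}{mp^{s-t}}}.$$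 Then the linearization disk of $P_\lambda$ exists and is exactly the open disk $\{x\in\mathbb{C}_p : |x|<r\}$ of radius $r=|1-\lambda|^{-1/p}\,\tilde r(\lambda)$. -/

import Mathlib

noncomputable section

namespace PadicLinearization

section Disks

variable {K : Type*} [NormedField K]

/-- A disk about the origin: an open or a closed disk of positive radius centred at `0`. -/
def IsDisk (D : Set K) : Prop :=
  ∃ r : ℝ, 0 < r ∧ (D = Metric.ball 0 r ∨ D = Metric.closedBall 0 r)

/-- The power series `H` converges at every point of `D`. -/
def ConvergesOn (H : PowerSeries K) (D : Set K) : Prop :=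
  ∀ x ∈ D, Summable fun k : ℕ => PowerSeries.coeff k H * x ^ k

/-- The sum of the power series `H` at `x` (only used at points of convergence). -/
def evalSeries (H : PowerSeries K) (x : K) : K :=
  ∑' k : ℕ, PowerSeries.coeff k H * x ^ k

/-- On the disk `D` the map `f` is analytically conjugate to the rotation `T : x ↦ lam * x`:
`f` maps `D` into itself, and there is a power series `H`, convergent on all of `D`, which maps
`D` bijectively onto a disk `E` about the origin and satisfies `H ∘ f = T ∘ H` on `D`. -/
def IsConjugateToRotationOn (f : K → K) (lam : K) (D : Set K) : Prop :=
  Set.MapsTo f D D ∧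
    ∃ (H : PowerSeries K) (E : Set K),
      IsDisk E ∧ ConvergesOn H D ∧ Set.BijOn (evalSeries H) D E ∧
        ∀ x ∈ D, evalSeries H (f x) = lam * evalSeries H x

/-- `D` is the linearization disk of `f`, a map with multiplier `lam` at the fixed point `0`:
the largest disk about the origin (open or closed) on which `f` is analytically conjugate to
`x ↦ lam * x`. -/
def IsLinearizationDisk (f : K → K) (lam : K) (D : Set K) : Prop :=
  IsGreatest {D' : Set K | IsDisk D' ∧ IsConjugateToRotationOn f lam D'} D

/-- The quadratic map `x ↦ lam * x + x ^ 2`. -/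
def quadraticMap (lam : K) (x : K) : K := lam * x + x ^ 2

end Disks

section Multiplier

variable (p : ℕ)

/-- `R 0 = 0` and `R s = p ^ (-1 / (p ^ (s - 1) * (p - 1)))` for `s ≥ 1`. -/
def R : ℕ → ℝ
  | 0 => 0
  | s + 1 => (p : ℝ) ^ (-(1 / ((p : ℝ) ^ s * ((p : ℝ) - 1))))

/-- The integer `j ≥ 0` for which `R j ≤ a < R (j + 1)` (unique when `0 ≤ a < 1`). -/
def level (a : ℝ) : ℕ := sInf {j : ℕ | R p j ≤ a ∧ a < R p (j + 1)}

variable [Fact p.Prime]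

/-- The roots of unity of `p`-power order in `ℂ_[p]`. -/
def rootsPPow : Set ℂ_[p] := {z | ∃ j : ℕ, z ^ p ^ j = 1}

variable {p}
variable (lam : ℂ_[p])

/-- `m`, the least `n ≥ 1` with `|1 - lam ^ n| < 1`. -/
def mIndex : ℕ := sInf {n : ℕ | 1 ≤ n ∧ ‖1 - lam ^ n‖ < 1}

/-- `γ₀`, a root of unity of `p`-power order at minimal distance from `lam ^ m`. -/
def nearestRoot : ℂ_[p] :=
  Classical.epsilon fun g : ℂ_[p] =>
    g ∈ rootsPPow p ∧ ∀ z ∈ rootsPPow p, ‖g - lam ^ mIndex lam‖ ≤ ‖z - lam ^ mIndex lam‖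

/-- `s`, determined by `R s ≤ |1 - lam ^ m| < R (s + 1)`. -/
def sIndex : ℕ := level p ‖1 - lam ^ mIndex lam‖

/-- `t`, determined by `R t ≤ |γ₀ - lam ^ m| < R (t + 1)`. -/
def tIndex : ℕ := level p ‖nearestRoot lam - lam ^ mIndex lam‖

/-- The function `lam ↦ r̃(lam)`, with `m`, `s`, `t`, `γ₀` as above:
`R(s+1)^{1/m} · p^{-(s-t)/(m p^s)} · |1-lam^m|^{s(p-1)/(m p)} · |γ₀-lam^m|^{1/(m p^{s-t})}`. -/
def rTilde : ℝ :=
  let m : ℝ := mIndex lam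
  let s : ℕ := sIndex lam
  let t : ℕ := tIndex lam
  R p (s + 1) ^ (1 / m)
    * (p : ℝ) ^ (-(((s : ℝ) - (t : ℝ)) / (m * (p : ℝ) ^ s)))
    * ‖1 - lam ^ mIndex lam‖ ^ ((s : ℝ) * (((p : ℝ) - 1) / (m * (p : ℝ))))
    * ‖nearestRoot lam - lam ^ mIndex lam‖ ^ (1 / (m * (p : ℝ) ^ ((s : ℝ) - (t : ℝ))))

end Multiplier

end PadicLinearization

end

/-! Comparing coefficients in `H(P(x)) = lam * H(x)` determines `H` up to a scalar: `lam * (1 - lam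
^ n) * h (n + 1)` is the sum over `l ≤ n` of `h l` times `l.choose (n + 1 - l)` and a power of the
unit `lam`. One term strictly dominates when `h 1 ≠ 0`: `l = n`, with binomial `n`, if `p ∤ n`; and
`l = n - 1`, with the unit binomial `(n - 1).choose 2`, if `p ∣ n`. Hence `‖h (n + 1)‖ = ‖h 1‖ *
coeffNorm lam n` exactly (`norm_coeff_eq`).

Since `‖1 - lam ^ i‖` depends only on the `p`-adic valuation of `i`, one gets `log (coeffNorm lam n)
= -∑ ⌊n / p ^ j⌋ w j` with all `w j ≤ 0` (`log_coeffNorm`). Dropping the floors gives an upper bound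
linear in `n`, and nothing is lost at `n = p ^ N`. The sum `∑ w j / p ^ j` is the logarithm of the
claimed radius `r`: the sizes `‖1 - lam ^ p ^ j‖` come from cyclotomic factorizations, after
dividing `lam` by a nearest root of unity (`norm_one_sub_pow_prime_pow_of_nearest`, `log_rTilde`).

So `coeffNorm lam n * r ^ n ≤ 1` for all `n`, which makes the normalized `H` a bijection of the open
disk of radius `r`. At large powers of `p` the same product equals `R p 1`, so the terms of a
nonzero `H` do not tend to `0` when `‖x‖ = r`, and no larger disk, not even the closed one, is
possible. -/

namespace PadicLinearization

/-! ### Ultrametric estimates. -/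

section Ultrametric

variable {K : Type*} [NormedField K] [IsUltrametricDist K]

theorem norm_sum_eq_of_forall_lt {ι : Type*} {s : Finset ι} {f : ι → K} {i : ι} (hi : i ∈ s)
    (h0 : f i ≠ 0) (h : ∀ j ∈ s, j ≠ i → ‖f j‖ < ‖f i‖) : ‖∑ j ∈ s, f j‖ = ‖f i‖ := by
  classical
  rw [← Finset.add_sum_erase s f hi]
  have hlt : ‖∑ j ∈ s.erase i, f j‖ < ‖f i‖ := by
    rcases (s.erase i).eq_empty_or_nonempty with he | hne
    · rw [he, Finset.sum_empty, norm_zero]; exact norm_pos_iff.2 h0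
    · obtain ⟨j, hj, hle⟩ := IsUltrametricDist.exists_norm_finsetSum_le_of_nonempty hne f
      exact hle.trans_lt (h j (Finset.mem_of_mem_erase hj) (Finset.ne_of_mem_erase hj))
  rw [IsUltrametricDist.norm_add_eq_max_of_norm_ne_norm hlt.ne', max_eq_left hlt.le]

theorem norm_pow_sub_pow_le {x y : K} {ρ : ℝ} (hx : ‖x‖ ≤ ρ) (hy : ‖y‖ ≤ ρ) (n : ℕ) :
    ‖x ^ (n + 1) - y ^ (n + 1)‖ ≤ ρ ^ n * ‖x - y‖ := by
  have hρ : 0 ≤ ρ := (norm_nonneg x).trans hx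
  rw [← geom_sum₂_mul x y (n + 1), norm_mul]
  gcongr
  refine IsUltrametricDist.norm_sum_le_of_forall_le_of_nonneg (by positivity) fun i hi => ?_
  have hi' : i + (n - i) = n := by have := Finset.mem_range.1 hi; omega
  rw [norm_mul, norm_pow, norm_pow, Nat.add_sub_cancel, ← hi', pow_add, hi']
  gcongr

end Ultrametric

/-! ### Substituting the quadratic map into a power series. -/

section Summability

variable {K : Type*} [NormedField K]

theorem norm_coeff_mul_pow_le {h : ℕ → K} {C ρ : ℝ} (hρ : 0 < ρ)
    (hh : ∀ k, ‖h k‖ * ρ ^ k ≤ C) (x : K) (k : ℕ) : ‖h k * x ^ k‖ ≤ C * (‖x‖ / ρ) ^ k := by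
  rw [norm_mul, norm_pow, div_pow, mul_div_assoc', le_div_iff₀ (by positivity)]
  have := mul_le_mul_of_nonneg_right (hh k) (pow_nonneg (norm_nonneg x) k)
  linarith

theorem summable_norm_coeff_mul_pow {h : ℕ → K} {C ρ : ℝ} (hρ : 0 < ρ)
    (hh : ∀ k, ‖h k‖ * ρ ^ k ≤ C) {x : K} (hx : ‖x‖ < ρ) :
    Summable fun k => ‖h k * x ^ k‖ := by
  refine Summable.of_nonneg_of_le (fun _ => norm_nonneg _) (norm_coeff_mul_pow_le hρ hh x)
    (Summable.mul_left _ (summable_geometric_of_lt_one (by positivity) ?_))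
  rwa [div_lt_one hρ]

/-- The coefficient of `x ^ k` in `∑ h l * (lam * x + x ^ 2) ^ l`. -/
def compCoeff (lam : K) (h : ℕ → K) (k : ℕ) : K :=
  ∑ q ∈ Finset.HasAntidiagonal.antidiagonal k, h q.1 * (q.1.choose q.2) * lam ^ (q.1 - q.2)

theorem quadraticMap_pow (lam x : K) (l : ℕ) :
    quadraticMap lam x ^ l =
      ∑ i ∈ Finset.range (l + 1), (l.choose i : K) * lam ^ (l - i) * x ^ (l + i) := by
  rw [quadraticMap, add_comm, add_pow]
  refine Finset.sum_congr rfl fun i hi => ?_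
  have hi' : l + i = (l - i) + 2 * i := by have := Finset.mem_range.1 hi; omega
  rw [hi', pow_add, mul_pow, pow_mul]
  ring

theorem hasSum_quadraticMap_pow (lam x : K) (l : ℕ) :
    HasSum (fun i : ℕ => (l.choose i : K) * lam ^ (l - i) * x ^ (l + i))
      (quadraticMap lam x ^ l) := by
  rw [quadraticMap_pow]
  refine hasSum_sum_of_ne_finset_zero fun i hi => ?_
  rw [Nat.choose_eq_zero_of_lt (by simpa using hi)]
  simp

variable [IsUltrametricDist K] [CompleteSpace K]

/-- A rearrangement of the double series over `(l, i)` obtained by expanding each power of `lam * x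
+ x ^ 2`. It is dominated by a product of geometric series, of ratio `‖x‖ / ρ` in `l` and `‖x‖` in
`i`; the latter is why `‖x‖ < 1` is required. -/
theorem hasSum_compCoeff {lam : K} (hlam : ‖lam‖ ≤ 1) {h : ℕ → K} {C ρ : ℝ} (hρ : 0 < ρ)
    (hh : ∀ k, ‖h k‖ * ρ ^ k ≤ C) {x : K} (hx : ‖x‖ < ρ) (hx1 : ‖x‖ < 1) :
    HasSum (fun k => compCoeff lam h k * x ^ k) (∑' l, h l * quadraticMap lam x ^ l) := by
  have hC : 0 ≤ C := le_trans (by positivity) (hh 0)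
  let u : ℕ × ℕ → K := fun q => h q.1 * (q.1.choose q.2) * lam ^ (q.1 - q.2) * x ^ (q.1 + q.2)
  have hu : Summable u := by
    refine Summable.of_norm_bounded (g := fun q : ℕ × ℕ => (C * (‖x‖ / ρ) ^ q.1) * ‖x‖ ^ q.2)
      ?_ ?_
    · refine Summable.mul_of_nonneg (f := fun l : ℕ => C * (‖x‖ / ρ) ^ l)
        (g := fun i : ℕ => ‖x‖ ^ i) ?_ ?_ ?_ ?_
      · refine Summable.mul_left _ (summable_geometric_of_lt_one (by positivity) ?_)
        rwa [div_lt_one hρ]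
      · exact summable_geometric_of_lt_one (norm_nonneg _) hx1
      · intro l; positivity
      · intro l; positivity
    · rintro ⟨l, i⟩
      have h1 : ‖((l.choose i : ℕ) : K)‖ ≤ 1 := IsUltrametricDist.norm_natCast_le_one K _
      have h2 : ‖lam ^ (l - i)‖ ≤ 1 := by
        rw [norm_pow]; exact pow_le_one₀ (norm_nonneg _) hlam
      have h3 := norm_coeff_mul_pow_le hρ hh x l
      calc ‖h l * (l.choose i) * lam ^ (l - i) * x ^ (l + i)‖
          = ‖h l * x ^ l‖ * ‖((l.choose i : ℕ) : K)‖ * ‖lam ^ (l - i)‖ * ‖x‖ ^ i := by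
            simp only [norm_mul, norm_pow, pow_add]; ring
        _ ≤ (C * (‖x‖ / ρ) ^ l) * 1 * 1 * ‖x‖ ^ i := by gcongr
        _ = _ := by ring
  have hS : HasSum u (∑' l, h l * quadraticMap lam x ^ l) := by
    have h1 : ∀ l, HasSum (fun i => u (l, i)) (h l * quadraticMap lam x ^ l) := fun l => by
      have := (hasSum_quadraticMap_pow lam x l).mul_left (h l)
      refine HasSum.congr_fun this fun i => ?_
      simp only [u]; ring
    have := hu.hasSum.prod_fiberwise h1
    rw [this.tsum_eq]; exact hu.hasSum
  have hS' := (Finset.HasAntidiagonal.sigmaAntidiagonalEquivProd (A := ℕ)).hasSum_iff.2 hS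
  have := hS'.sigma (g := fun k => compCoeff lam h k * x ^ k) fun k => by
    have e : compCoeff lam h k * x ^ k = ∑ q ∈ Finset.HasAntidiagonal.antidiagonal k, u q := by
      simp only [compCoeff, Finset.sum_mul]
      refine Finset.sum_congr rfl fun q hq => ?_
      simp only [u]; rw [Finset.HasAntidiagonal.mem_antidiagonal.1 hq]
    rw [e]
    exact Finset.hasSum (Finset.HasAntidiagonal.antidiagonal k) u
  exact this

end Summability

/-! ### Uniqueness of power series coefficients. -/

section Uniqueness

variable {K : Type*} [NontriviallyNormedField K]

theorem coeff_eq_of_hasSum_eq {a b : ℕ → K} {F : K → K} {ρ : ℝ} (hρ : 0 < ρ)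
    (ha : ∀ x : K, ‖x‖ < ρ → HasSum (fun k => a k * x ^ k) (F x))
    (hb : ∀ x : K, ‖x‖ < ρ → HasSum (fun k => b k * x ^ k) (F x)) : a = b := by
  have key : ∀ c : ℕ → K, (∀ x : K, ‖x‖ < ρ → HasSum (fun k => c k * x ^ k) (F x)) →
      HasFPowerSeriesAt F (FormalMultilinearSeries.ofScalars K c) 0 := by
    intro c hc
    rw [hasFPowerSeriesAt_iff]
    filter_upwards [Metric.ball_mem_nhds (0 : K) hρ] with x hx
    have := hc x (by simpa using hx)
    rw [zero_add]
    refine HasSum.congr_fun this fun k => ?_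
    rw [FormalMultilinearSeries.coeff_ofScalars, smul_eq_mul, mul_comm]
  have := (key a ha).eq_formalMultilinearSeries (key b hb)
  exact FormalMultilinearSeries.ofScalars_series_injective K K this

end Uniqueness

/-! ### Bijectivity of series tangent to the identity. -/

section Bijection

variable {K : Type*} [NormedField K] [IsUltrametricDist K]

/-- The nonlinear part of a power series tangent to the identity is contracting. -/
theorem norm_evalSeries_sub_sub_le {h : ℕ → K} {r ρ : ℝ} (h1 : h 1 = 1)
    (hr : 0 < r) (hh : ∀ n, ‖h (n + 1)‖ * r ^ n ≤ 1) (hρ : ρ < r) {x y : K} (hx : ‖x‖ ≤ ρ)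
    (hy : ‖y‖ ≤ ρ) (hsx : Summable fun k => h k * x ^ k) (hsy : Summable fun k => h k * y ^ k) :
    ‖(∑' k, h k * x ^ k) - (∑' k, h k * y ^ k) - (x - y)‖ ≤ ρ / r * ‖x - y‖ := by
  have hρ0 : 0 ≤ ρ := (norm_nonneg x).trans hx
  have e : (∑' k, h k * x ^ k) - (∑' k, h k * y ^ k) - (x - y)
      = ∑' n, h (n + 2) * (x ^ (n + 2) - y ^ (n + 2)) := by
    have hs := hsx.sub hsy
    rw [← hsx.tsum_sub hsy, hs.tsum_eq_zero_add, ((summable_nat_add_iff 1).2 hs).tsum_eq_zero_add]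
    simp only [pow_zero, zero_add, pow_one, h1, sub_self, one_mul, add_sub_cancel_left]
    refine tsum_congr fun n => ?_
    rw [show n + 1 + 1 = n + 2 from rfl, mul_sub]
  rw [e]
  refine IsUltrametricDist.norm_tsum_le_of_forall_le_of_nonneg (by positivity) fun n => ?_
  have a1 := norm_pow_sub_pow_le hx hy (n + 1)
  have a2 := hh (n + 1)
  have q1 : (ρ / r) ^ (n + 1) ≤ ρ / r := by
    rw [pow_succ]
    exact mul_le_of_le_one_left (by positivity)
      (pow_le_one₀ (by positivity) ((div_le_one hr).2 hρ.le))
  calc ‖h (n + 2) * (x ^ (n + 2) - y ^ (n + 2))‖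
      ≤ ‖h (n + 2)‖ * (ρ ^ (n + 1) * ‖x - y‖) := by rw [norm_mul]; gcongr
    _ = ‖h (n + 2)‖ * r ^ (n + 1) * ((ρ / r) ^ (n + 1) * ‖x - y‖) := by
        rw [div_pow]; field_simp
    _ ≤ 1 * (ρ / r * ‖x - y‖) := by gcongr
    _ = _ := one_mul _

variable [CompleteSpace K]

/-- On each closed ball of radius `ρ < r` the series is the identity plus a map with Lipschitz
constant `ρ / r < 1`. -/
theorem bijOn_ball_tsum {h : ℕ → K} {r : ℝ} (h0 : h 0 = 0) (h1 : h 1 = 1)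
    (hr : 0 < r) (hh : ∀ n, ‖h (n + 1)‖ * r ^ n ≤ 1)
    (hs : ∀ x : K, ‖x‖ < r → Summable fun k => h k * x ^ k) :
    Set.BijOn (fun x => ∑' k, h k * x ^ k) (Metric.ball 0 r) (Metric.ball 0 r) := by
  set F : K → K := fun x => ∑' k, h k * x ^ k with hF
  have hF0 : F 0 = 0 := by
    simp only [hF]
    rw [tsum_eq_zero_add' (by simp [summable_zero])]
    simp [h0]
  have key : ∀ {ρ : ℝ}, ρ < r → ∀ {x y : K}, ‖x‖ ≤ ρ → ‖y‖ ≤ ρ →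
      ‖F x - F y - (x - y)‖ ≤ ρ / r * ‖x - y‖ := fun {ρ} hρ {x y} hx hy =>
    norm_evalSeries_sub_sub_le h1 hr hh hρ hx hy (hs x (hx.trans_lt hρ)) (hs y (hy.trans_lt hρ))
  refine ⟨fun x hx => ?_, fun x hx y hy hxy => ?_, fun y hy => ?_⟩
  · rw [mem_ball_zero_iff] at hx ⊢
    have := key hx le_rfl (y := 0) (by simp)
    rw [hF0, sub_zero, sub_zero] at this
    have h2 : ‖x‖ / r * ‖x‖ ≤ ‖x‖ :=
      mul_le_of_le_one_left (norm_nonneg _) ((div_le_one hr).2 hx.le)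
    have h3 := IsUltrametricDist.norm_add_le_max (F x - x) x
    rw [sub_add_cancel] at h3
    exact h3.trans_lt (max_lt ((this.trans h2).trans_lt hx) hx)
  · rw [mem_ball_zero_iff] at hx hy
    by_contra hne
    have hpos : 0 < ‖x - y‖ := norm_pos_iff.2 (sub_ne_zero.2 hne)
    have hm : max ‖x‖ ‖y‖ < r := max_lt hx hy
    have := key hm (le_max_left _ _) (le_max_right ‖x‖ ‖y‖)
    rw [show F x = F y from hxy, sub_self, zero_sub, norm_neg] at this
    have h2 := (div_lt_one hr).2 hm
    nlinarith
  · rw [mem_ball_zero_iff] at hy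
    -- A preimage of `y` is a fixed point of `x ↦ y - (F x - x)`, a contraction of ratio `‖y‖ / r`
    -- on the complete ball of radius `‖y‖`.
    have hmaps : Set.MapsTo (fun x => y - (F x - x)) (Metric.closedBall 0 ‖y‖)
        (Metric.closedBall 0 ‖y‖) := by
      intro x hx
      rw [mem_closedBall_zero_iff] at hx ⊢
      have := key hy hx (y := 0) (by simp)
      rw [hF0, sub_zero, sub_zero] at this
      have h2 : ‖y‖ / r * ‖x‖ ≤ ‖y‖ :=
        (mul_le_of_le_one_left (norm_nonneg _) ((div_le_one hr).2 hy.le)).trans hx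
      have h3 := IsUltrametricDist.norm_add_le_max y (-(F x - x))
      rw [← sub_eq_add_neg, norm_neg] at h3
      exact h3.trans (max_le le_rfl (this.trans h2))
    have hcon : ContractingWith (Real.toNNReal (‖y‖ / r))
        (hmaps.restrict _ _ _) := by
      refine ⟨?_, LipschitzWith.of_dist_le_mul ?_⟩
      · rw [Real.toNNReal_lt_one]; exact (div_lt_one hr).2 hy
      · rintro ⟨a, ha⟩ ⟨b, hb⟩
        rw [mem_closedBall_zero_iff] at ha hb
        have := key hy hb ha
        simp only [Subtype.dist_eq, Set.MapsTo.val_restrict_apply, dist_eq_norm]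
        rw [Real.coe_toNNReal _ (by positivity), norm_sub_rev a b]
        refine le_of_eq_of_le (congrArg norm ?_) this
        ring
    obtain ⟨x, hx, hfix, -⟩ := hcon.exists_fixedPoint' Metric.isClosed_closedBall.isComplete hmaps
      (Metric.mem_closedBall_self (norm_nonneg y)) (edist_ne_top _ _)
    refine ⟨x, ?_, ?_⟩
    · rw [mem_closedBall_zero_iff] at hx
      rw [mem_ball_zero_iff]; exact hx.trans_lt hy
    · have : y - (F x - x) = x := hfix
      have : y = F x := by linear_combination this
      exact this.symm

end Bijection

end PadicLinearization

/-! ### Exact size of the coefficients of the linearization. -/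

namespace PadicLinearization

variable {p : ℕ} [Fact p.Prime]

theorem norm_natCast_prime : ‖(p : ℂ_[p])‖ = (p : ℝ)⁻¹ := by
  have := PadicComplex.norm_extends' p (p : ℚ_[p])
  rw [Padic.norm_p] at this
  rw [← this]
  simp

theorem norm_natCast_of_not_dvd {n : ℕ} (hn : ¬ p ∣ n) : ‖(n : ℂ_[p])‖ = 1 := by
  have := PadicComplex.norm_extends' p (n : ℚ_[p])
  rw [Padic.norm_natCast_eq_one_iff.2 ((Nat.Prime.coprime_iff_not_dvd Fact.out).2 hn)] at this
  rw [← this]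
  simp

theorem norm_natCast_of_dvd {n : ℕ} (hn : p ∣ n) : ‖(n : ℂ_[p])‖ ≤ (p : ℝ)⁻¹ := by
  obtain ⟨m, rfl⟩ := hn
  rw [Nat.cast_mul, norm_mul, norm_natCast_prime]
  exact mul_le_of_le_one_right (by positivity) (IsUltrametricDist.norm_natCast_le_one _ _)

variable {lam : ℂ_[p]}

theorem norm_eq_one_of_norm_one_sub_lt (h : ‖1 - lam‖ < 1) : ‖lam‖ = 1 := by
  have e : lam = 1 + -(1 - lam) := by ring
  have h1 : ‖(1 : ℂ_[p])‖ ≠ ‖-(1 - lam)‖ := by rw [norm_neg, norm_one]; exact h.ne'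
  rw [e, IsUltrametricDist.norm_add_eq_max_of_norm_ne_norm h1, norm_neg, norm_one,
    max_eq_left h.le]

theorem norm_one_sub_pow_le (h : ‖1 - lam‖ < 1) (n : ℕ) : ‖1 - lam ^ n‖ ≤ ‖1 - lam‖ := by
  rw [← one_pow n]
  rcases n with _ | n
  · simp
  · have := norm_pow_sub_pow_le (x := 1) (y := lam) (ρ := 1) (by simp)
      (norm_eq_one_of_norm_one_sub_lt h).le n
    simpa using this

/-- The quotient of `1 - lam ^ n` by `1 - lam` is a sum of `n` powers of `lam`, each congruent to
`1`, hence is congruent to the unit `n` modulo the maximal ideal. -/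
theorem norm_one_sub_pow_of_not_dvd (h : ‖1 - lam‖ < 1) {n : ℕ} (hn : ¬ p ∣ n) :
    ‖1 - lam ^ n‖ = ‖1 - lam‖ := by
  rw [← mul_neg_geom_sum, norm_mul]
  have h1 : ‖(∑ i ∈ Finset.range n, lam ^ i) - (n : ℂ_[p])‖ < 1 := by
    have : (∑ i ∈ Finset.range n, lam ^ i) - (n : ℂ_[p])
        = ∑ i ∈ Finset.range n, (lam ^ i - 1) := by simp
    rw [this]
    refine lt_of_le_of_lt (IsUltrametricDist.norm_sum_le_of_forall_le_of_nonneg (norm_nonneg _)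
      fun i _ => ?_) h
    rw [norm_sub_rev]; exact norm_one_sub_pow_le h i
  have h2 : ‖∑ i ∈ Finset.range n, lam ^ i‖ = 1 := by
    have e : ∑ i ∈ Finset.range n, lam ^ i
        = (n : ℂ_[p]) + ((∑ i ∈ Finset.range n, lam ^ i) - (n : ℂ_[p])) := by ring
    rw [e, IsUltrametricDist.norm_add_eq_max_of_norm_ne_norm, norm_natCast_of_not_dvd hn,
      max_eq_left h1.le]
    rw [norm_natCast_of_not_dvd hn]; exact h1.ne'
  rw [h2, mul_one]

variable (lam) in
/-- The norm of the coefficient of `x ^ (n + 1)` in the linearization of `lam * x + x ^ 2`. -/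
noncomputable def coeffNorm (n : ℕ) : ℝ :=
  ‖1 - lam‖ ^ (n / p) / ∏ i ∈ Finset.range n, ‖1 - lam ^ (i + 1)‖

@[simp] theorem coeffNorm_zero : coeffNorm lam 0 = 1 := by simp [coeffNorm]

theorem coeffNorm_succ_of_not_dvd {n : ℕ} (hn : ¬ p ∣ n + 1) :
    coeffNorm lam (n + 1) = coeffNorm lam n / ‖1 - lam ^ (n + 1)‖ := by
  rw [coeffNorm, coeffNorm, Finset.prod_range_succ, Nat.succ_div_of_not_dvd hn, div_div]

theorem coeffNorm_succ_of_dvd {n : ℕ} (hn : p ∣ n + 1) :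
    coeffNorm lam (n + 1) = coeffNorm lam n * ‖1 - lam‖ / ‖1 - lam ^ (n + 1)‖ := by
  rw [coeffNorm, coeffNorm, Finset.prod_range_succ, Nat.succ_div_of_dvd hn, pow_succ]
  ring

theorem norm_one_sub_pow_pos (hroot : ∀ n : ℕ, 1 ≤ n → lam ^ n ≠ 1) (n : ℕ) :
    0 < ‖1 - lam ^ (n + 1)‖ :=
  norm_pos_iff.2 (sub_ne_zero.2 (hroot (n + 1) (by omega)).symm)

theorem norm_one_sub_pos (hroot : ∀ n : ℕ, 1 ≤ n → lam ^ n ≠ 1) : 0 < ‖1 - lam‖ := by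
  simpa using norm_one_sub_pow_pos hroot 0

theorem coeffNorm_pos (hroot : ∀ n : ℕ, 1 ≤ n → lam ^ n ≠ 1) (n : ℕ) : 0 < coeffNorm lam n :=
  div_pos (pow_pos (norm_one_sub_pos hroot) _)
    (Finset.prod_pos fun i _ => norm_one_sub_pow_pos hroot i)

/-- Monotonicity lets a single term dominate the recursion: the later the coefficient, the larger it
is. -/
theorem coeffNorm_strictMono (hroot : ∀ n : ℕ, 1 ≤ n → lam ^ n ≠ 1) (hupp : ‖1 - lam‖ < 1)
    (hsq : ‖1 - lam ^ p‖ < ‖1 - lam‖) : StrictMono (coeffNorm lam) := by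
  refine strictMono_nat_of_lt_succ fun n => ?_
  have hB := coeffNorm_pos hroot n
  by_cases hn : p ∣ n + 1
  · rw [coeffNorm_succ_of_dvd hn, lt_div_iff₀ (norm_one_sub_pow_pos hroot n)]
    obtain ⟨m, hm⟩ := hn
    gcongr
    rw [hm, pow_mul]
    exact (norm_one_sub_pow_le (hsq.trans hupp) m).trans_lt hsq
  · rw [coeffNorm_succ_of_not_dvd hn, norm_one_sub_pow_of_not_dvd hupp hn,
      lt_div_iff₀ (norm_one_sub_pos hroot)]
    exact mul_lt_of_lt_one_right hB hupp

theorem compCoeff_succ (h : ℕ → ℂ_[p]) (n : ℕ) :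
    compCoeff lam h (n + 1) = (∑ l ∈ Finset.range (n + 1),
      h l * (l.choose (n + 1 - l)) * lam ^ (l - (n + 1 - l))) + h (n + 1) * lam ^ (n + 1) := by
  rw [compCoeff, Finset.Nat.sum_antidiagonal_eq_sum_range_succ_mk, Finset.sum_range_succ]
  simp

theorem not_dvd_choose_two {n : ℕ} (hp : 3 ≤ p) (hn : p ∣ n + 3) : ¬ p ∣ (n + 2).choose 2 := by
  intro hdvd
  have hpp : p.Prime := Fact.out
  have h2 : (n + 2).choose 2 * 2 = (n + 2) * (n + 1) := by
    rw [Nat.choose_two_right]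
    exact Nat.div_mul_cancel (by
      rw [mul_comm]; exact (Nat.even_mul_succ_self (n + 1)).two_dvd)
  have h3 : p ∣ (n + 2) * (n + 1) := h2 ▸ dvd_mul_of_dvd_left hdvd 2
  rcases (Nat.Prime.dvd_mul hpp).1 h3 with h | h
  · have := (Nat.dvd_sub hn h)
    rw [show n + 3 - (n + 2) = 1 by omega] at this
    exact absurd (Nat.le_of_dvd one_pos this) (by omega)
  · have := (Nat.dvd_sub hn h)
    rw [show n + 3 - (n + 1) = 2 by omega] at this
    exact absurd (Nat.le_of_dvd two_pos this) (by omega)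

/-- The exact size of the coefficients of any series conjugating `lam * x + x ^ 2` to its
linear part. -/
theorem norm_coeff_eq (hp : 3 ≤ p) (hroot : ∀ n : ℕ, 1 ≤ n → lam ^ n ≠ 1)
    (hlow : 1 / (p : ℝ) < ‖1 - lam‖) (hupp : ‖1 - lam‖ < 1)
    (hsq : ‖1 - lam ^ p‖ < ‖1 - lam‖) {h : ℕ → ℂ_[p]} (h0 : h 0 = 0)
    (hrec : ∀ k, compCoeff lam h k = lam * h k) (n : ℕ) :
    ‖h (n + 1)‖ = ‖h 1‖ * coeffNorm lam n := by
  induction n using Nat.strong_induction_on with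
  | _ n ih =>
  rcases n with _ | n
  · simp
  have hlam := norm_eq_one_of_norm_one_sub_lt hupp
  have hmono := coeffNorm_strictMono hroot hupp hsq
  have hd := norm_one_sub_pos hroot
  set f : ℕ → ℂ_[p] := fun l =>
    h l * (l.choose (n + 1 + 1 - l)) * lam ^ (l - (n + 1 + 1 - l)) with hf
  have hfn : ∀ l, l ≤ n → ‖f (l + 1)‖
      = ‖h 1‖ * coeffNorm lam l * ‖(((l + 1).choose (n + 1 - l) : ℕ) : ℂ_[p])‖ := by
    intro l hl
    simp only [hf, norm_mul, norm_pow, hlam, one_pow, mul_one]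
    rw [ih l (by omega), show n + 1 + 1 - (l + 1) = n + 1 - l by omega]
  have hf0 : f 0 = 0 := by simp [hf, h0]
  have hsum : lam * (1 - lam ^ (n + 1)) * h (n + 1 + 1) = ∑ l ∈ Finset.range (n + 1 + 1), f l := by
    have := hrec (n + 1 + 1)
    rw [compCoeff_succ] at this
    linear_combination -this
  have hnorm : ‖1 - lam ^ (n + 1)‖ * ‖h (n + 1 + 1)‖ = ‖∑ l ∈ Finset.range (n + 1 + 1), f l‖ := by
    rw [← hsum, norm_mul, norm_mul, hlam, one_mul]
  have hcle : ∀ m : ℕ, ‖(m : ℂ_[p])‖ ≤ 1 := IsUltrametricDist.norm_natCast_le_one _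
  have hpos := norm_one_sub_pow_pos hroot n
  suffices hmain : ‖∑ l ∈ Finset.range (n + 1 + 1), f l‖
      = ‖1 - lam ^ (n + 1)‖ * (‖h 1‖ * coeffNorm lam (n + 1)) by
    rw [hmain] at hnorm
    exact mul_left_cancel₀ hpos.ne' hnorm
  -- If `h 1 = 0`, all terms vanish and there is no strictly dominant one, so this case is separate.
  rcases eq_or_lt_of_le (norm_nonneg (h 1)) with hz | hβ
  · have : ∀ l ∈ Finset.range (n + 1 + 1), f l = 0 := by
      intro l hl
      rcases l with _ | l
      · exact hf0
      · rw [← norm_eq_zero, hfn l (by have := Finset.mem_range.1 hl; omega), ← hz]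
        simp
    rw [Finset.sum_eq_zero this, ← hz]; simp
  have hB := fun m => coeffNorm_pos hroot m
  -- When `p ∣ n + 1` the binomial of the last term is `n + 1`, which is small, so the previous
  -- term, with a unit binomial, takes over.
  by_cases hn : p ∣ n + 1
  · obtain ⟨k, rfl⟩ : ∃ k, n = k + 2 :=
      ⟨n - 2, by have := Nat.le_of_dvd (by omega) hn; omega⟩
    have hch : ‖(((k + 2).choose 2 : ℕ) : ℂ_[p])‖ = 1 :=
      norm_natCast_of_not_dvd (not_dvd_choose_two hp hn)
    have hndvd : ¬ p ∣ k + 1 + 1 := fun hdvd => by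
      have := (Nat.dvd_sub hn hdvd)
      rw [show k + 2 + 1 - (k + 1 + 1) = 1 by omega] at this
      exact absurd (Nat.le_of_dvd one_pos this) (by omega)
    have hstep : coeffNorm lam (k + 2) = coeffNorm lam (k + 1) / ‖1 - lam‖ := by
      rw [coeffNorm_succ_of_not_dvd hndvd, norm_one_sub_pow_of_not_dvd hupp hndvd]
    have hdom : ‖f (k + 2)‖ = ‖h 1‖ * coeffNorm lam (k + 1) := by
      rw [hfn (k + 1) (by omega), show k + 2 + 1 - (k + 1) = 2 by omega, hch, mul_one]
    rw [norm_sum_eq_of_forall_lt (i := k + 2) (by simp) _ _, hdom, coeffNorm_succ_of_dvd hn, hstep]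
    · field_simp
    · rw [← norm_pos_iff, hdom]; exact mul_pos hβ (hB _)
    · intro l hl hne
      rw [hdom]
      have hl' := Finset.mem_range.1 hl
      rcases l with _ | l
      · rw [hf0, norm_zero]; exact mul_pos hβ (hB _)
      rw [hfn l (by omega), mul_assoc]
      refine mul_lt_mul_of_pos_left ?_ hβ
      -- The last term has the larger coefficient, by a factor `1 / ‖1 - lam‖`, but its binomial
      -- costs a factor at most `1 / p`. The hypothesis `1 / p < ‖1 - lam‖` decides in favour of the
      -- other term.
      rcases (show l = k + 2 ∨ l < k + 1 by omega) with rfl | hlt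
      · rw [show k + 2 + 1 - (k + 2) = 1 by omega, Nat.choose_one_right, hstep]
        calc coeffNorm lam (k + 1) / ‖1 - lam‖ * ‖((k + 2 + 1 : ℕ) : ℂ_[p])‖
            ≤ coeffNorm lam (k + 1) / ‖1 - lam‖ * (p : ℝ)⁻¹ := by
              have := norm_natCast_of_dvd hn
              have := hB (k + 1)
              gcongr
          _ < coeffNorm lam (k + 1) / ‖1 - lam‖ * ‖1 - lam‖ := by
              have := hB (k + 1)
              rw [one_div] at hlow
              gcongr
          _ = _ := div_mul_cancel₀ _ hd.ne'
      · exact (mul_le_of_le_one_right (hB l).le (hcle _)).trans_lt (hmono hlt)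
  · have hdom : ‖f (n + 1)‖ = ‖h 1‖ * coeffNorm lam n := by
      rw [hfn n le_rfl, show n + 1 - n = 1 by omega, Nat.choose_one_right,
        norm_natCast_of_not_dvd hn, mul_one]
    rw [norm_sum_eq_of_forall_lt (i := n + 1) (by simp) _ _, hdom, coeffNorm_succ_of_not_dvd hn]
    · field_simp
    · rw [← norm_pos_iff, hdom]; exact mul_pos hβ (hB n)
    · intro l hl hne
      rw [hdom]
      have hl' := Finset.mem_range.1 hl
      rcases l with _ | l
      · rw [hf0, norm_zero]; exact mul_pos hβ (hB n)
      rw [hfn l (by omega), mul_assoc]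
      refine mul_lt_mul_of_pos_left ?_ hβ
      exact (mul_le_of_le_one_right (hB l).le (hcle _)).trans_lt (hmono (by omega))

variable (lam) in
/-- The coefficients of the linearization of `lam * x + x ^ 2` tangent to the identity. -/
noncomputable def linCoeff : ℕ → ℂ_[p]
  | 0 => 0
  | 1 => 1
  | n + 2 => (lam * (1 - lam ^ (n + 1)))⁻¹ *
      ∑ l : Fin (n + 2), linCoeff l * ((l : ℕ).choose (n + 2 - l)) * lam ^ ((l : ℕ) - (n + 2 - l))

theorem compCoeff_linCoeff (hroot : ∀ n : ℕ, 1 ≤ n → lam ^ n ≠ 1) (hlam : lam ≠ 0) (k : ℕ) :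
    compCoeff lam (linCoeff lam) k = lam * linCoeff lam k := by
  rcases k with _ | _ | n
  · simp [compCoeff, linCoeff]
  · simp [compCoeff_succ, linCoeff]
  · have h1 : 1 - lam ^ (n + 1) ≠ 0 := sub_ne_zero.2 (hroot (n + 1) (by omega)).symm
    have h2 : lam * (1 - lam ^ (n + 1)) * linCoeff lam (n + 2) = ∑ l ∈ Finset.range (n + 2),
        linCoeff lam l * (l.choose (n + 2 - l)) * lam ^ (l - (n + 2 - l)) := by
      rw [linCoeff, mul_inv_cancel_left₀ (mul_ne_zero hlam h1), Finset.sum_range]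
    rw [compCoeff_succ, show n + 1 + 1 = n + 2 from rfl, ← h2]
    ring

end PadicLinearization

/-! ### The radii `R` and the level of a real number. -/

namespace PadicLinearization

open Filter Topology

section Radii

variable {p : ℕ} [Fact p.Prime]

theorem one_lt_cast_prime : (1 : ℝ) < p := by exact_mod_cast (Fact.out : p.Prime).one_lt

theorem R_succ_pos (i : ℕ) : 0 < R p (i + 1) :=
  Real.rpow_pos_of_pos (one_pos.trans one_lt_cast_prime) _

theorem log_R_succ (i : ℕ) :
    Real.log (R p (i + 1)) = -(Real.log p / ((p : ℝ) ^ i * ((p : ℝ) - 1))) := by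
  rw [R, Real.log_rpow (one_pos.trans one_lt_cast_prime)]
  ring

theorem R_succ_pow (i : ℕ) : R p (i + 1) ^ (p ^ i * (p - 1)) = (p : ℝ)⁻¹ := by
  have hp1 := one_lt_cast_prime (p := p)
  have hp1' : (p : ℝ) - 1 ≠ 0 := (sub_pos.2 hp1).ne'
  rw [R, ← Real.rpow_natCast, ← Real.rpow_mul (by positivity)]
  push_cast [Nat.cast_sub (Fact.out : p.Prime).one_le]
  rw [neg_mul, one_div, inv_mul_cancel₀ (by positivity), Real.rpow_neg_one]

theorem R_strictMono : StrictMono (R p) := by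
  have hp1 := one_lt_cast_prime (p := p)
  refine strictMono_nat_of_lt_succ fun i => ?_
  rcases i with _ | i
  · exact R_succ_pos 0
  · refine Real.rpow_lt_rpow_of_exponent_lt hp1 (neg_lt_neg ?_)
    have := sub_pos.2 hp1
    refine one_div_lt_one_div_of_lt (by positivity) ?_
    gcongr
    exact i.lt_succ_self

theorem tendsto_R_succ : Tendsto (fun i => R p (i + 1)) atTop (𝓝 1) := by
  have hp1 := one_lt_cast_prime (p := p)
  have h1 : Tendsto (fun i : ℕ => -(1 / ((p : ℝ) ^ i * ((p : ℝ) - 1)))) atTop (𝓝 0) := by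
    rw [← neg_zero]
    refine Tendsto.neg ?_
    simp only [one_div]
    exact tendsto_inv_atTop_zero.comp
      ((tendsto_pow_atTop_atTop_of_one_lt hp1).atTop_mul_const (sub_pos.2 hp1))
  have h2 := ((Real.continuous_const_rpow (a := (p : ℝ)) (by positivity)).tendsto 0).comp h1
  rwa [Real.rpow_zero] at h2

theorem exists_lt_R_succ {a : ℝ} (ha : a < 1) : ∃ i, a < R p (i + 1) :=
  (tendsto_R_succ.eventually_const_lt ha).exists

theorem level_spec {a : ℝ} (h0 : 0 ≤ a) (h1 : a < 1) :
    R p (level p a) ≤ a ∧ a < R p (level p a + 1) := by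
  classical
  refine Nat.sInf_mem (s := {j : ℕ | R p j ≤ a ∧ a < R p (j + 1)}) ?_
  have hex := exists_lt_R_succ (p := p) h1
  refine ⟨Nat.find hex, ?_, Nat.find_spec hex⟩
  rcases hj : Nat.find hex with _ | j
  · exact h0
  · exact not_lt.1 (Nat.find_min hex (by omega))

end Radii

/-! ### Roots of unity of `p`-power order and the sizes of `1 - lam ^ p ^ j`. -/

section RootsOfUnity

variable {p : ℕ} [Fact p.Prime]

theorem norm_eq_one_of_mem_rootsPPow {z : ℂ_[p]} (hz : z ∈ rootsPPow p) : ‖z‖ = 1 := by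
  obtain ⟨j, hj⟩ := hz
  have := congrArg norm hj
  rw [norm_pow, norm_one] at this
  exact (pow_eq_one_iff_of_nonneg (norm_nonneg z) (pow_ne_zero _ (Fact.out : p.Prime).ne_zero)).1
    this

theorem mul_mem_rootsPPow {z w : ℂ_[p]} (hz : z ∈ rootsPPow p) (hw : w ∈ rootsPPow p) :
    z * w ∈ rootsPPow p := by
  obtain ⟨i, hi⟩ := hz
  obtain ⟨j, hj⟩ := hw
  refine ⟨i + j, ?_⟩
  rw [mul_pow, pow_add, pow_mul, hi, one_pow, one_mul, mul_comm, pow_mul, hj, one_pow]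

theorem one_mem_rootsPPow : (1 : ℂ_[p]) ∈ rootsPPow p := ⟨0, by simp⟩

theorem exists_isPrimitiveRoot_of_mem_rootsPPow {z : ℂ_[p]} (hz : z ∈ rootsPPow p) (h1 : z ≠ 1) :
    ∃ i, IsPrimitiveRoot z (p ^ (i + 1)) := by
  obtain ⟨j, hj⟩ := hz
  obtain ⟨k, -, hk⟩ := (Nat.dvd_prime_pow Fact.out).1 (orderOf_dvd_of_pow_eq_one hj)
  rcases k with _ | k
  · rw [pow_zero, orderOf_eq_one_iff] at hk
    exact absurd hk h1
  · exact ⟨k, hk ▸ IsPrimitiveRoot.orderOf z⟩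

theorem exists_isPrimitiveRoot_prime_pow (i : ℕ) : ∃ z : ℂ_[p], IsPrimitiveRoot z (p ^ i) := by
  have : NeZero ((p ^ i : ℕ) : ℂ_[p]) :=
    ⟨Nat.cast_ne_zero.2 (pow_ne_zero _ (Fact.out : p.Prime).ne_zero)⟩
  exact HasEnoughRootsOfUnity.exists_primitiveRoot ℂ_[p] (p ^ i)

theorem card_primitiveRoots_prime_pow (i : ℕ) :
    (primitiveRoots (p ^ (i + 1)) ℂ_[p]).card = p ^ i * (p - 1) := by
  obtain ⟨z, hz⟩ := exists_isPrimitiveRoot_prime_pow (p := p) (i + 1)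
  rw [hz.card_primitiveRoots, Nat.totient_prime_pow_succ Fact.out]

theorem eval_cyclotomic_prime_pow (x : ℂ_[p]) (i : ℕ) :
    (Polynomial.cyclotomic (p ^ (i + 1)) ℂ_[p]).eval x
      = ∏ z ∈ primitiveRoots (p ^ (i + 1)) ℂ_[p], (x - z) := by
  obtain ⟨z, hz⟩ := exists_isPrimitiveRoot_prime_pow (p := p) (i + 1)
  rw [Polynomial.cyclotomic_eq_prod_X_sub_primitiveRoots hz, Polynomial.eval_prod]
  simp

theorem isPrimitiveRoot_of_mem {i : ℕ} {z : ℂ_[p]}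
    (hz : z ∈ primitiveRoots (p ^ (i + 1)) ℂ_[p]) : IsPrimitiveRoot z (p ^ (i + 1)) :=
  (mem_primitiveRoots (pow_pos (Fact.out : p.Prime).pos _)).1 hz

theorem norm_one_sub_pow_prime_pow_succ (x : ℂ_[p]) (i : ℕ) :
    ‖1 - x ^ p ^ (i + 1)‖
      = ‖1 - x ^ p ^ i‖ * ∏ z ∈ primitiveRoots (p ^ (i + 1)) ℂ_[p], ‖x - z‖ := by
  have h := congrArg (Polynomial.eval x)
    (Polynomial.cyclotomic_prime_pow_mul_X_pow_sub_one ℂ_[p] p i)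
  simp only [Polynomial.eval_mul, Polynomial.eval_sub, Polynomial.eval_pow, Polynomial.eval_X,
    Polynomial.eval_one] at h
  rw [norm_sub_rev, ← h, norm_mul, eval_cyclotomic_prime_pow, norm_prod, mul_comm, norm_sub_rev]

theorem norm_one_sub_pow_prime_pow_succ_of_forall {x : ℂ_[p]} {i : ℕ} {c : ℝ}
    (h : ∀ z : ℂ_[p], IsPrimitiveRoot z (p ^ (i + 1)) → ‖x - z‖ = c) :
    ‖1 - x ^ p ^ (i + 1)‖ = ‖1 - x ^ p ^ i‖ * c ^ (p ^ i * (p - 1)) := by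
  rw [norm_one_sub_pow_prime_pow_succ,
    Finset.prod_congr rfl fun z hz => h z (isPrimitiveRoot_of_mem hz), Finset.prod_const,
    card_primitiveRoots_prime_pow]

/-- Primitive roots of the same order are powers of one another, hence equidistant from `1`. The
product of these distances is the norm of the cyclotomic value `p` at `1`. -/
theorem norm_one_sub_of_isPrimitiveRoot {z : ℂ_[p]} {i : ℕ} (hz : IsPrimitiveRoot z (p ^ (i + 1))) :
    ‖1 - z‖ = R p (i + 1) := by
  have hle : ∀ {z w : ℂ_[p]}, IsPrimitiveRoot z (p ^ (i + 1)) → IsPrimitiveRoot w (p ^ (i + 1)) →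
      ‖1 - w‖ ≤ ‖1 - z‖ := by
    intro z w hz hw
    have : NeZero (p ^ (i + 1)) := ⟨pow_ne_zero _ (Fact.out : p.Prime).ne_zero⟩
    obtain ⟨n, -, rfl⟩ := hz.eq_pow_of_pow_eq_one hw.pow_eq_one
    rcases n with _ | n
    · simp
    · have := norm_pow_sub_pow_le (x := 1) (y := z) (ρ := 1) (by simp)
        (norm_eq_one_of_mem_rootsPPow ⟨_, hz.pow_eq_one⟩).le n
      simpa using this
  have h := eval_cyclotomic_prime_pow (p := p) 1 i
  rw [Polynomial.eval_one_cyclotomic_prime_pow] at h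
  replace h := congrArg norm h
  rw [norm_natCast_prime, norm_prod, Finset.prod_congr rfl fun w hw =>
    le_antisymm (hle hz (isPrimitiveRoot_of_mem hw)) (hle (isPrimitiveRoot_of_mem hw) hz),
    Finset.prod_const, card_primitiveRoots_prime_pow, ← R_succ_pow i] at h
  refine ((pow_left_inj₀ (R_succ_pos i).le (norm_nonneg _) ?_).1 h).symm
  exact mul_ne_zero (pow_ne_zero _ (Fact.out : p.Prime).ne_zero)
    (Nat.sub_ne_zero_of_lt (Fact.out : p.Prime).one_lt)

theorem norm_sub_primitiveRoot {x z : ℂ_[p]} {i : ℕ} (hz : IsPrimitiveRoot z (p ^ (i + 1)))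
    (hne : ‖1 - x‖ ≠ R p (i + 1)) : ‖x - z‖ = max ‖1 - x‖ (R p (i + 1)) := by
  rw [← norm_one_sub_of_isPrimitiveRoot hz] at hne ⊢
  have e : x - z = -(1 - x) + (1 - z) := by ring
  rw [e, IsUltrametricDist.norm_add_eq_max_of_norm_ne_norm (by rwa [norm_neg]), norm_neg]

theorem norm_sub_primitiveRoot_le {x z : ℂ_[p]} {i : ℕ} (hz : IsPrimitiveRoot z (p ^ (i + 1))) :
    ‖x - z‖ ≤ max ‖1 - x‖ (R p (i + 1)) := by
  rw [← norm_one_sub_of_isPrimitiveRoot hz]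
  have e : x - z = -(1 - x) + (1 - z) := by ring
  have := IsUltrametricDist.norm_add_le_max (-(1 - x)) (1 - z)
  rwa [← e, norm_neg] at this

theorem norm_one_sub_pow_prime_pow_of_forall {x : ℂ_[p]} {j : ℕ}
    (h : ∀ i < j, ∀ z : ℂ_[p], IsPrimitiveRoot z (p ^ (i + 1)) → ‖x - z‖ = ‖1 - x‖) :
    ‖1 - x ^ p ^ j‖ = ‖1 - x‖ ^ p ^ j := by
  induction j with
  | zero => simp
  | succ j ih =>
    rw [norm_one_sub_pow_prime_pow_succ_of_forall (h j j.lt_succ_self),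
      ih fun i hi => h i (hi.trans j.lt_succ_self), ← pow_add]
    congr 1
    obtain ⟨q, hq⟩ : ∃ q, p = q + 1 := ⟨p - 1, by have := (Fact.out : p.Prime).pos; omega⟩
    simp only [hq, Nat.add_sub_cancel]
    ring

theorem norm_one_sub_pow_prime_pow_of_lt {x : ℂ_[p]} {s j : ℕ} (hs : R p s ≤ ‖1 - x‖)
    (hj : j < s) : ‖1 - x ^ p ^ j‖ = ‖1 - x‖ ^ p ^ j := by
  refine norm_one_sub_pow_prime_pow_of_forall fun i hi z hz => ?_
  have : R p (i + 1) < ‖1 - x‖ := (R_strictMono (by omega)).trans_le hs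
  rw [norm_sub_primitiveRoot hz this.ne', max_eq_left this.le]

/-- Up to level `t` all primitive roots are at distance `‖1 - x‖` from `x`; minimality is needed for
this when `‖1 - x‖ = R p t`. Above level `t` the roots of level `i` are at distance `R p i`, and
each level contributes a factor `1 / p`. -/
theorem norm_one_sub_pow_prime_pow_add {x : ℂ_[p]} {t : ℕ} (ht : R p t ≤ ‖1 - x‖)
    (ht' : ‖1 - x‖ < R p (t + 1)) (hmin : ∀ z ∈ rootsPPow p, ‖1 - x‖ ≤ ‖x - z‖) (k : ℕ) :
    ‖1 - x ^ p ^ (t + k)‖ = ‖1 - x‖ ^ p ^ t / (p : ℝ) ^ k := by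
  induction k with
  | zero =>
    rw [pow_zero, div_one, add_zero]
    refine norm_one_sub_pow_prime_pow_of_forall fun i hi z hz => ?_
    have hle : R p (i + 1) ≤ ‖1 - x‖ := (R_strictMono.monotone hi).trans ht
    refine le_antisymm ?_ (hmin z ⟨_, hz.pow_eq_one⟩)
    exact (norm_sub_primitiveRoot_le hz).trans (max_le le_rfl hle)
  | succ k ih =>
    rw [← add_assoc, norm_one_sub_pow_prime_pow_succ_of_forall (c := R p (t + k + 1)), ih,
      R_succ_pow, pow_succ, div_mul_eq_div_div, div_eq_mul_inv _ (p : ℝ)]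
    intro z hz
    have hlt : ‖1 - x‖ < R p (t + k + 1) := ht'.trans_le (R_strictMono.monotone (by omega))
    rw [norm_sub_primitiveRoot hz hlt.ne, max_eq_right hlt.le]

/-- The sizes of `1 - lam ^ p ^ j`, in terms of a `p`-power root of unity `g` nearest to `lam`. -/
theorem norm_one_sub_pow_prime_pow_of_nearest {lam g : ℂ_[p]} {s t : ℕ} (hg : g ∈ rootsPPow p)
    (hmin : ∀ z ∈ rootsPPow p, ‖g - lam‖ ≤ ‖z - lam‖)
    (hs : R p s ≤ ‖1 - lam‖) (hs' : ‖1 - lam‖ < R p (s + 1))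
    (ht : R p t ≤ ‖g - lam‖) (ht' : ‖g - lam‖ < R p (t + 1)) :
    t ≤ s ∧ ∀ k, ‖1 - lam ^ p ^ (s + k)‖ = ‖g - lam‖ ^ p ^ t / (p : ℝ) ^ (s - t + k) := by
  have hle := hmin 1 one_mem_rootsPPow
  have hts : t ≤ s := by
    have := R_strictMono.lt_iff_lt.1 ((ht.trans hle).trans_lt hs')
    omega
  refine ⟨hts, ?_⟩
  -- The point `x` is `lam` if `1` is itself a nearest root, and `lam * g⁻¹` otherwise, so that `1`
  -- is nearest to `x` in both cases.
  suffices H : ∃ x : ℂ_[p], ‖1 - x‖ = ‖g - lam‖ ∧ (∀ z ∈ rootsPPow p, ‖1 - x‖ ≤ ‖x - z‖) ∧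
      ∀ k, x ^ p ^ (s + k) = lam ^ p ^ (s + k) by
    obtain ⟨x, hx, hxmin, hxpow⟩ := H
    intro k
    have := norm_one_sub_pow_prime_pow_add (hx ▸ ht) (hx ▸ ht') hxmin (s - t + k)
    rwa [show t + (s - t + k) = s + k by omega, hxpow, hx] at this
  rcases hle.eq_or_lt with heq | hlt
  · exact ⟨lam, heq.symm, fun z hz => by rw [← heq, norm_sub_rev lam z]; exact hmin z hz,
      fun _ => rfl⟩
  · have hg0 : g ≠ 0 := norm_pos_iff.1 (by rw [norm_eq_one_of_mem_rootsPPow hg]; exact one_pos)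
    have hd : ‖1 - g‖ = ‖1 - lam‖ := by
      have e : 1 - g = (1 - lam) + -(g - lam) := by ring
      rw [e, IsUltrametricDist.norm_add_eq_max_of_norm_ne_norm (by rw [norm_neg]; exact hlt.ne'),
        norm_neg, max_eq_left hlt.le]
    have hg1 : g ≠ 1 := by
      rintro rfl
      exact hlt.false
    obtain ⟨u, hu⟩ := exists_isPrimitiveRoot_of_mem_rootsPPow hg hg1
    rw [norm_one_sub_of_isPrimitiveRoot hu] at hd
    rw [← hd] at hs hs'
    -- The distance `‖1 - g‖ = ‖1 - lam‖` forces `g` to have order exactly `p ^ s`, so the twist by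
    -- `g` disappears in the powers `p ^ (s + k)`.
    have hus : u + 1 = s := by
      have h1 := R_strictMono.le_iff_le.1 hs
      have h2 := R_strictMono.lt_iff_lt.1 hs'
      omega
    have hnx : ∀ z, ‖lam * g⁻¹ - z‖ = ‖z * g - lam‖ := by
      intro z
      have e : lam * g⁻¹ - z = (lam - z * g) * g⁻¹ := by field_simp
      rw [e, norm_mul, norm_inv, norm_eq_one_of_mem_rootsPPow hg, inv_one, mul_one, norm_sub_rev]
    have hn1 : ‖1 - lam * g⁻¹‖ = ‖g - lam‖ := by rw [norm_sub_rev, hnx, one_mul]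
    refine ⟨lam * g⁻¹, hn1, fun z hz => ?_, fun k => ?_⟩
    · rw [hn1, hnx]; exact hmin _ (mul_mem_rootsPPow hz hg)
    · rw [mul_pow, inv_pow, pow_add p, pow_mul g, ← hus, hu.pow_eq_one, one_pow, inv_one, mul_one]

/-- Only finitely many roots compete: once `R p (i + 1) > ‖1 - lam‖`, the primitive roots of order
`p ^ (i + 1)` are farther from `lam` than `1` is. -/
theorem exists_nearest_rootsPPow {lam : ℂ_[p]} (h : ‖1 - lam‖ < 1) :
    ∃ g ∈ rootsPPow p, ∀ z ∈ rootsPPow p, ‖g - lam‖ ≤ ‖z - lam‖ := by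
  obtain ⟨N, hN⟩ := exists_lt_R_succ (p := p) h
  have hpos : 0 < p ^ (N + 1) := pow_pos (Fact.out : p.Prime).pos _
  have h1 : (1 : ℂ_[p]) ∈ Polynomial.nthRootsFinset (p ^ (N + 1)) (1 : ℂ_[p]) := by
    rw [Polynomial.mem_nthRootsFinset hpos, one_pow]
  obtain ⟨g, hg, hmin⟩ := Finset.exists_min_image _ (fun z => ‖z - lam‖) ⟨1, h1⟩
  refine ⟨g, ⟨_, (Polynomial.mem_nthRootsFinset hpos _).1 hg⟩, fun z hz => ?_⟩
  rcases eq_or_ne z 1 with rfl | hz1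
  · exact hmin 1 h1
  obtain ⟨i, hi⟩ := exists_isPrimitiveRoot_of_mem_rootsPPow hz hz1
  rcases le_or_gt i N with hiN | hiN
  · refine hmin z ((Polynomial.mem_nthRootsFinset hpos _).2 ?_)
    rw [show N + 1 = (i + 1) + (N - i) by omega, pow_add, pow_mul, hi.pow_eq_one, one_pow]
  · have hlt : ‖1 - lam‖ < R p (i + 1) := hN.trans (R_strictMono (by omega))
    rw [norm_sub_rev z, norm_sub_primitiveRoot hi hlt.ne, max_eq_right hlt.le]
    exact (hmin 1 h1).trans hlt.le

/-- This inequality makes the weight `logWeight lam 1` nonpositive. If the maximum below is `R p 1`,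
its power is `1 / p`, and the lower bound on `‖1 - lam‖` applies. -/
theorem norm_one_sub_pow_prime_le_sq (hp : 3 ≤ p) {lam : ℂ_[p]}
    (hlow : 1 / (p : ℝ) < ‖1 - lam‖) (hupp : ‖1 - lam‖ < 1) :
    ‖1 - lam ^ p‖ ≤ ‖1 - lam‖ ^ 2 := by
  have h := norm_one_sub_pow_prime_pow_succ lam 0
  rw [zero_add, pow_one, pow_zero, pow_one] at h
  rw [h, sq]
  gcongr
  calc ∏ z ∈ primitiveRoots p ℂ_[p], ‖lam - z‖
      ≤ ∏ z ∈ primitiveRoots p ℂ_[p], max ‖1 - lam‖ (R p 1) := by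
        refine Finset.prod_le_prod (fun _ _ => norm_nonneg _) fun z hz => ?_
        have hz' := isPrimitiveRoot_of_mem (p := p) (i := 0) (by simpa using hz)
        exact norm_sub_primitiveRoot_le hz'
    _ = (max ‖1 - lam‖ (R p 1)) ^ (p - 1) := by
        have := card_primitiveRoots_prime_pow (p := p) 0
        rw [zero_add, pow_one, pow_zero, one_mul] at this
        rw [Finset.prod_const, this]
    _ ≤ ‖1 - lam‖ := by
        rcases max_choice ‖1 - lam‖ (R p 1) with h | h <;> rw [h]
        · exact pow_le_of_le_one (norm_nonneg _) hupp.le (by omega)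
        · have := R_succ_pow (p := p) 0
          rw [zero_add, pow_zero, one_mul] at this
          rw [this, ← one_div]
          exact hlow.le

end RootsOfUnity

end PadicLinearization

/-! ### Logarithmic growth of the coefficients and the radius. -/

namespace PadicLinearization

theorem sum_sum_ite_pow_dvd (p : ℕ) (c : ℕ → ℝ) (J n : ℕ) :
    ∑ i ∈ Finset.range n, ∑ j ∈ Finset.range J, (if p ^ j ∣ i + 1 then c j else 0)
      = ∑ j ∈ Finset.range J, ((n / p ^ j : ℕ) : ℝ) * c j := by
  induction n with
  | zero => simp
  | succ n ih =>
    rw [Finset.sum_range_succ, ih, ← Finset.sum_add_distrib]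
    refine Finset.sum_congr rfl fun j _ => ?_
    rw [Nat.succ_div]
    split_ifs
    · push_cast; ring
    · simp

variable {p : ℕ} [Fact p.Prime] {lam : ℂ_[p]}

variable (lam) in
/-- `log |1 - lam ^ p ^ j|`. -/
noncomputable def logDist (j : ℕ) : ℝ := Real.log ‖1 - lam ^ p ^ j‖

variable (lam) in
/-- The weights `w j` for which `-log |b (n + 1)| = ∑ j, ⌊n / p ^ j⌋ * w j`, where `b` are the
coefficients of the linearization. -/
noncomputable def logWeight : ℕ → ℝ
  | 0 => logDist lam 0
  | 1 => logDist lam 1 - 2 * logDist lam 0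
  | j + 2 => logDist lam (j + 2) - logDist lam (j + 1)

theorem sum_range_logWeight (v : ℕ) :
    ∑ j ∈ Finset.range (v + 2), logWeight lam j = logDist lam (v + 1) - logDist lam 0 := by
  induction v with
  | zero => simp [Finset.sum_range_succ, logWeight]; ring
  | succ v ih => rw [Finset.sum_range_succ, ih, logWeight]; ring

theorem norm_one_sub_pow_prime_pow_lt_one (hupp : ‖1 - lam‖ < 1) (j : ℕ) :
    ‖1 - lam ^ p ^ j‖ < 1 :=
  (norm_one_sub_pow_le hupp _).trans_lt hupp

theorem norm_one_sub_pow_prime_pow_pos (hroot : ∀ n : ℕ, 1 ≤ n → lam ^ n ≠ 1) (j : ℕ) :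
    0 < ‖1 - lam ^ p ^ j‖ :=
  norm_pos_iff.2 (sub_ne_zero.2 (hroot _ (pow_pos (Fact.out : p.Prime).pos j)).symm)

theorem logDist_zero : logDist lam 0 = Real.log ‖1 - lam‖ := by simp [logDist]

theorem logWeight_nonpos (hroot : ∀ n : ℕ, 1 ≤ n → lam ^ n ≠ 1) (hupp : ‖1 - lam‖ < 1)
    (hsq : ‖1 - lam ^ p‖ ≤ ‖1 - lam‖ ^ 2) (j : ℕ) : logWeight lam j ≤ 0 := by
  rcases j with _ | _ | j
  · exact Real.log_nonpos (norm_nonneg _) (norm_one_sub_pow_prime_pow_lt_one hupp 0).le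
  · have h := Real.log_le_log (by simpa using norm_one_sub_pow_prime_pow_pos hroot 1) hsq
    rw [Real.log_pow] at h
    rw [zero_add, logWeight, logDist_zero, logDist, pow_one]
    push_cast at h
    linarith
  · rw [logWeight, sub_nonpos]
    refine Real.log_le_log (norm_one_sub_pow_prime_pow_pos hroot _) ?_
    rw [pow_succ p (j + 1), pow_mul]
    exact norm_one_sub_pow_le (norm_one_sub_pow_prime_pow_lt_one hupp _) _

/-- If `p ^ v` exactly divides `n + 1`, the weights up to `v` telescope to `logDist lam v`, less
`logDist lam 0` when `v ≥ 1`. That correction is the factor `‖1 - lam‖` entering the numerator of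
`coeffNorm` at multiples of `p`. The bound `J` is only a truncation. -/
theorem log_coeffNorm_succ (hroot : ∀ n : ℕ, 1 ≤ n → lam ^ n ≠ 1) (hupp : ‖1 - lam‖ < 1)
    {n J : ℕ} (hn : n + 1 < p ^ J) :
    Real.log (coeffNorm lam (n + 1)) = Real.log (coeffNorm lam n)
      - ∑ j ∈ Finset.range J, (if p ^ j ∣ n + 1 then logWeight lam j else 0) := by
  have hpp : p.Prime := Fact.out
  obtain ⟨v, m, hm, hvm⟩ := Nat.exists_eq_pow_mul_and_not_dvd n.succ_ne_zero p hpp.ne_one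
  replace hvm : n + 1 = p ^ v * m := hvm
  have hnorm : ‖1 - lam ^ (n + 1)‖ = ‖1 - lam ^ p ^ v‖ := by
    rw [hvm, pow_mul]
    exact norm_one_sub_pow_of_not_dvd (norm_one_sub_pow_prime_pow_lt_one hupp v) hm
  have hdvd : ∀ j, p ^ j ∣ n + 1 ↔ j ≤ v := by
    intro j
    rw [hvm]
    refine ⟨fun h => ?_, fun h => (pow_dvd_pow p h).mul_right m⟩
    by_contra hlt
    obtain ⟨k, rfl⟩ : ∃ k, j = v + 1 + k := ⟨j - (v + 1), by omega⟩
    have h2 := (pow_dvd_pow p (Nat.le_add_right (v + 1) k)).trans h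
    rw [pow_succ] at h2
    exact hm (Nat.dvd_of_mul_dvd_mul_left (pow_pos hpp.pos v) h2)
  have hvJ : v < J := by
    refine (Nat.pow_lt_pow_iff_right hpp.one_lt).1 (lt_of_le_of_lt ?_ hn)
    exact Nat.le_of_dvd n.succ_pos ((hdvd v).2 le_rfl)
  have hsum : ∑ j ∈ Finset.range J, (if p ^ j ∣ n + 1 then logWeight lam j else 0)
      = ∑ j ∈ Finset.range (v + 1), logWeight lam j := by
    rw [← Finset.sum_filter]
    refine Finset.sum_congr ?_ fun _ _ => rfl
    ext j
    simp only [Finset.mem_filter, Finset.mem_range, hdvd]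
    omega
  have hd := norm_one_sub_pos hroot
  have hB := coeffNorm_pos hroot n
  have hv := norm_one_sub_pow_prime_pow_pos hroot v
  rw [hsum]
  rcases v with _ | v
  · have hnd : ¬ p ∣ n + 1 := fun h => by
      have := (hdvd 1).1 (by simpa using h)
      omega
    rw [coeffNorm_succ_of_not_dvd hnd, hnorm, Real.log_div hB.ne' hv.ne']
    simp [logWeight, logDist]
  · have hdv : p ∣ n + 1 := by simpa using (hdvd 1).2 (by omega)
    rw [coeffNorm_succ_of_dvd hdv, hnorm, Real.log_div (mul_pos hB hd).ne' hv.ne',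
      Real.log_mul hB.ne' hd.ne', sum_range_logWeight, logDist_zero, logDist]
    ring

theorem log_coeffNorm (hroot : ∀ n : ℕ, 1 ≤ n → lam ^ n ≠ 1) (hupp : ‖1 - lam‖ < 1)
    {n J : ℕ} (hn : n < p ^ J) : Real.log (coeffNorm lam n)
      = -∑ j ∈ Finset.range J, ((n / p ^ j : ℕ) : ℝ) * logWeight lam j := by
  rw [← sum_sum_ite_pow_dvd]
  induction n with
  | zero => simp
  | succ n ih =>
    rw [log_coeffNorm_succ hroot hupp hn, ih (by omega), Finset.sum_range_succ]
    ring

variable (lam) in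
/-- The partial sums of the series for the logarithm of the linearization radius. -/
noncomputable def logRadiusSum (J : ℕ) : ℝ := ∑ j ∈ Finset.range J, logWeight lam j / (p : ℝ) ^ j

theorem log_coeffNorm_le (hroot : ∀ n : ℕ, 1 ≤ n → lam ^ n ≠ 1) (hupp : ‖1 - lam‖ < 1)
    (hsq : ‖1 - lam ^ p‖ ≤ ‖1 - lam‖ ^ 2) {n J : ℕ} (hn : n < p ^ J) :
    Real.log (coeffNorm lam n) ≤ -(n * logRadiusSum lam J) := by
  rw [log_coeffNorm hroot hupp hn, logRadiusSum, Finset.mul_sum, neg_le_neg_iff]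
  refine Finset.sum_le_sum fun j _ => ?_
  rw [mul_div_assoc', mul_div_right_comm]
  refine mul_le_mul_of_nonpos_right ?_ (logWeight_nonpos hroot hupp hsq j)
  exact_mod_cast Nat.cast_div_le (α := ℝ) (m := n) (n := p ^ j)

/-- For `n = p ^ N` all floors with `j ≤ N` are exact, so the general upper bound is attained. -/
theorem log_coeffNorm_prime_pow (hroot : ∀ n : ℕ, 1 ≤ n → lam ^ n ≠ 1) (hupp : ‖1 - lam‖ < 1)
    (N : ℕ) :
    Real.log (coeffNorm lam (p ^ N)) = -((p : ℝ) ^ N * logRadiusSum lam (N + 1)) := by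
  have hpp : p.Prime := Fact.out
  rw [log_coeffNorm hroot hupp (Nat.pow_lt_pow_right hpp.one_lt N.lt_succ_self), logRadiusSum,
    Finset.mul_sum]
  congr 1
  refine Finset.sum_congr rfl fun j hj => ?_
  have hj' : j ≤ N := by have := Finset.mem_range.1 hj; omega
  have hp0 : (p : ℝ) ≠ 0 := Nat.cast_ne_zero.2 hpp.ne_zero
  rw [Nat.cast_div (pow_dvd_pow p hj') (by exact_mod_cast pow_ne_zero j hp0)]
  push_cast
  ring

/-- Summation by parts. -/
theorem logRadiusSum_eq (J : ℕ) : logRadiusSum lam (J + 2)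
    = (∑ j ∈ Finset.range (J + 1), logDist lam j / (p : ℝ) ^ j * (1 - 1 / (p : ℝ)))
      + logDist lam (J + 1) / (p : ℝ) ^ (J + 1) - logDist lam 0 / p := by
  have hp0 : (p : ℝ) ≠ 0 := Nat.cast_ne_zero.2 (Fact.out : p.Prime).ne_zero
  induction J with
  | zero =>
    simp [logRadiusSum, Finset.sum_range_succ, logWeight]
    field_simp
    ring
  | succ J ih =>
    rw [logRadiusSum, Finset.sum_range_succ, ← logRadiusSum, ih, Finset.sum_range_succ _ (J + 1),
      logWeight]
    generalize ∑ j ∈ Finset.range (J + 1), logDist lam j / (p : ℝ) ^ j * (1 - 1 / (p : ℝ)) = S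
    field_simp
    ring

theorem mIndex_eq_one (hupp : ‖1 - lam‖ < 1) : mIndex lam = 1 := by
  refine le_antisymm (Nat.sInf_le ⟨le_rfl, by simpa using hupp⟩) ?_
  exact (Nat.sInf_mem (s := {n : ℕ | 1 ≤ n ∧ ‖1 - lam ^ n‖ < 1}) ⟨1, le_rfl, by simpa using hupp⟩).1

theorem nearestRoot_spec (hupp : ‖1 - lam‖ < 1) :
    nearestRoot lam ∈ rootsPPow p ∧ ∀ z ∈ rootsPPow p, ‖nearestRoot lam - lam‖ ≤ ‖z - lam‖ := by
  obtain ⟨g, hg, hmin⟩ := exists_nearest_rootsPPow hupp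
  have := Classical.epsilon_spec (p := fun g : ℂ_[p] => g ∈ rootsPPow p ∧
    ∀ z ∈ rootsPPow p, ‖g - lam ^ mIndex lam‖ ≤ ‖z - lam ^ mIndex lam‖)
    ⟨g, hg, by simpa [mIndex_eq_one hupp] using hmin⟩
  simpa only [nearestRoot, mIndex_eq_one hupp, pow_one] using this

theorem nearestRoot_sub_pos (hroot : ∀ n : ℕ, 1 ≤ n → lam ^ n ≠ 1) (hupp : ‖1 - lam‖ < 1) :
    0 < ‖nearestRoot lam - lam‖ := by
  rw [norm_pos_iff, sub_ne_zero]
  intro h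
  obtain ⟨j, hj⟩ := (nearestRoot_spec hupp).1
  exact hroot _ (pow_pos (Fact.out : p.Prime).pos j) (h ▸ hj)

theorem rTilde_pos (hroot : ∀ n : ℕ, 1 ≤ n → lam ^ n ≠ 1) (hupp : ‖1 - lam‖ < 1) :
    0 < rTilde lam := by
  have h1 := norm_one_sub_pos hroot
  have h2 := nearestRoot_sub_pos hroot hupp
  have h3 := R_succ_pos (p := p) (sIndex lam)
  have h4 := one_pos.trans (one_lt_cast_prime (p := p))
  simp only [rTilde, mIndex_eq_one hupp, pow_one]
  positivity

/-- The first `s` summands are equal and give the power of `‖1 - lam‖` in `rTilde`. From index `s`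
on, `logDist` drops by `log p` at each step, so increasing `k` changes both sides by the same term
of a geometric series. -/
theorem log_rTilde (hroot : ∀ n : ℕ, 1 ≤ n → lam ^ n ≠ 1) (hupp : ‖1 - lam‖ < 1) (k : ℕ) :
    Real.log (rTilde lam) + Real.log p / ((p : ℝ) ^ (sIndex lam + k) * ((p : ℝ) - 1))
      = (∑ j ∈ Finset.range (sIndex lam + k), logDist lam j / (p : ℝ) ^ j * (1 - 1 / (p : ℝ)))
        + logDist lam (sIndex lam + k) / (p : ℝ) ^ (sIndex lam + k) := by
  have h1 := norm_one_sub_pos hroot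
  have h2 := nearestRoot_sub_pos hroot hupp
  have h3 := R_succ_pos (p := p) (sIndex lam)
  have hp1 := one_lt_cast_prime (p := p)
  have hp0 := one_pos.trans hp1
  have hp1' := sub_pos.2 hp1
  obtain ⟨hg, hmin⟩ := nearestRoot_spec hupp
  have hle := hmin 1 one_mem_rootsPPow
  obtain ⟨hs, hs'⟩ := level_spec (p := p) h1.le hupp
  obtain ⟨ht, ht'⟩ := level_spec (p := p) h2.le (hle.trans_lt hupp)
  have hsI : sIndex lam = level p ‖1 - lam‖ := by rw [sIndex, mIndex_eq_one hupp, pow_one]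
  have htI : tIndex lam = level p ‖nearestRoot lam - lam‖ := by
    rw [tIndex, mIndex_eq_one hupp, pow_one]
  rw [← hsI] at hs hs'
  rw [← htI] at ht ht'
  obtain ⟨hts, hdist⟩ := norm_one_sub_pow_prime_pow_of_nearest hg hmin hs hs' ht ht'
  have hLs : ∀ k : ℕ, logDist lam (sIndex lam + k) = (p : ℝ) ^ tIndex lam *
      Real.log ‖nearestRoot lam - lam‖ - ((sIndex lam : ℝ) - tIndex lam + k) * Real.log p := by
    intro k
    rw [logDist, hdist, Real.log_div (by positivity) (by positivity), Real.log_pow, Real.log_pow]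
    push_cast [Nat.cast_sub hts]
    ring
  induction k with
  | zero =>
    have hsum : ∑ j ∈ Finset.range (sIndex lam),
        logDist lam j / (p : ℝ) ^ j * (1 - 1 / (p : ℝ))
        = sIndex lam * (Real.log ‖1 - lam‖ * (1 - 1 / (p : ℝ))) := by
      rw [Finset.sum_congr rfl (g := fun _ => Real.log ‖1 - lam‖ * (1 - 1 / (p : ℝ)))]
      · simp
      · intro j hj
        rw [logDist, norm_one_sub_pow_prime_pow_of_lt hs (Finset.mem_range.1 hj), Real.log_pow]
        push_cast
        field_simp
    have hrt : (p : ℝ) ^ ((sIndex lam : ℝ) - tIndex lam)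
        = (p : ℝ) ^ sIndex lam / (p : ℝ) ^ tIndex lam := by
      rw [Real.rpow_sub hp0, Real.rpow_natCast, Real.rpow_natCast]
    have hlog : Real.log (rTilde lam) = Real.log (R p (sIndex lam + 1))
        - ((sIndex lam : ℝ) - tIndex lam) / (p : ℝ) ^ sIndex lam * Real.log p
        + sIndex lam * (((p : ℝ) - 1) / p) * Real.log ‖1 - lam‖
        + (p : ℝ) ^ tIndex lam / (p : ℝ) ^ sIndex lam * Real.log ‖nearestRoot lam - lam‖ := by
      simp only [rTilde, mIndex_eq_one hupp, pow_one, Nat.cast_one, one_mul, div_one,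
        Real.rpow_one, hrt]
      rw [Real.log_mul (by positivity) (by positivity), Real.log_mul (by positivity)
        (by positivity), Real.log_mul (by positivity) (by positivity), Real.log_rpow h2,
        Real.log_rpow h1, Real.log_rpow hp0, one_div_div]
      ring
    have := hLs 0
    rw [add_zero] at this ⊢
    rw [hsum, this, hlog, log_R_succ]
    push_cast
    field_simp
    ring
  | succ k ih =>
    rw [← add_assoc, Finset.sum_range_succ]
    have e1 := hLs k
    have e2 := hLs (k + 1)
    rw [← add_assoc] at e2
    have e3 : logDist lam (sIndex lam + k + 1) = logDist lam (sIndex lam + k) - Real.log p := by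
      rw [e1, e2]; push_cast; ring
    rw [e3]
    have e4 : Real.log p / ((p : ℝ) ^ (sIndex lam + k + 1) * ((p : ℝ) - 1))
        = Real.log p / ((p : ℝ) ^ (sIndex lam + k) * ((p : ℝ) - 1))
          - Real.log p / (p : ℝ) ^ (sIndex lam + k + 1) := by
      field_simp
      ring
    rw [e4]
    have e5 : logDist lam (sIndex lam + k) / (p : ℝ) ^ (sIndex lam + k) * (1 - 1 / (p : ℝ))
        = logDist lam (sIndex lam + k) / (p : ℝ) ^ (sIndex lam + k)
          - logDist lam (sIndex lam + k) / (p : ℝ) ^ (sIndex lam + k + 1) := by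
      field_simp
      ring
    rw [e5, sub_div]
    linarith

variable (lam) in
/-- The radius of the linearization disk of `lam * x + x ^ 2`. -/
noncomputable def linRadius : ℝ := ‖1 - lam‖ ^ (-(1 / (p : ℝ))) * rTilde lam

theorem linRadius_pos (hroot : ∀ n : ℕ, 1 ≤ n → lam ^ n ≠ 1) (hupp : ‖1 - lam‖ < 1) :
    0 < linRadius lam :=
  mul_pos (Real.rpow_pos_of_pos (norm_one_sub_pos hroot) _) (rTilde_pos hroot hupp)

theorem logRadiusSum_eq_log_linRadius (hroot : ∀ n : ℕ, 1 ≤ n → lam ^ n ≠ 1)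
    (hupp : ‖1 - lam‖ < 1) {J : ℕ} (hJ : sIndex lam ≤ J + 1) :
    logRadiusSum lam (J + 2)
      = Real.log (linRadius lam) + Real.log p / ((p : ℝ) ^ (J + 1) * ((p : ℝ) - 1)) := by
  have h1 := norm_one_sub_pos hroot
  obtain ⟨k, hk⟩ := Nat.exists_eq_add_of_le hJ
  have h := log_rTilde hroot hupp k
  rw [← hk] at h
  rw [logRadiusSum_eq, ← h, linRadius, Real.log_mul (Real.rpow_pos_of_pos h1 _).ne'
    (rTilde_pos hroot hupp).ne', Real.log_rpow h1, logDist_zero]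
  ring

theorem coeffNorm_mul_linRadius_pow_le (hroot : ∀ n : ℕ, 1 ≤ n → lam ^ n ≠ 1)
    (hupp : ‖1 - lam‖ < 1) (hsq : ‖1 - lam ^ p‖ ≤ ‖1 - lam‖ ^ 2) (n : ℕ) :
    coeffNorm lam n * linRadius lam ^ n ≤ 1 := by
  have hB := coeffNorm_pos hroot n
  have hr := linRadius_pos hroot hupp
  have hp1 := one_lt_cast_prime (p := p)
  -- The exponent only has to exceed the base-`p` length of `n` and be past `sIndex lam`; the excess
  -- of the partial sum over `log r` is positive and can be discarded.
  have hn : n < p ^ (n + sIndex lam + 2) :=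
    ((n.lt_pow_self (Fact.out : p.Prime).one_lt)).trans_le
      (Nat.pow_le_pow_right (Fact.out : p.Prime).pos (by omega))
  have h := log_coeffNorm_le hroot hupp hsq hn
  rw [logRadiusSum_eq_log_linRadius hroot hupp (by omega)] at h
  have h2 : 0 ≤ Real.log p / ((p : ℝ) ^ (n + sIndex lam + 1) * ((p : ℝ) - 1)) := by
    have := Real.log_pos hp1
    have := sub_pos.2 hp1
    positivity
  rw [← Real.log_nonpos_iff (by positivity), Real.log_mul hB.ne' (by positivity), Real.log_pow]
  have := mul_nonneg n.cast_nonneg h2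
  linarith

/-- Here the excess of the partial sum, multiplied by `p ^ (N + 1)`, is `log p / (p - 1)` whatever
`N` is. This is the obstruction to convergence on the boundary. -/
theorem coeffNorm_mul_linRadius_pow_prime_pow (hroot : ∀ n : ℕ, 1 ≤ n → lam ^ n ≠ 1)
    (hupp : ‖1 - lam‖ < 1) {N : ℕ} (hN : sIndex lam ≤ N + 1) :
    coeffNorm lam (p ^ (N + 1)) * linRadius lam ^ p ^ (N + 1) = R p 1 := by
  have hB := coeffNorm_pos hroot (p ^ (N + 1))
  have hr := linRadius_pos hroot hupp
  have hp1 := one_lt_cast_prime (p := p)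
  have hp1' := sub_pos.2 hp1
  refine Real.log_injOn_pos (Set.mem_Ioi.2 (by positivity)) (R_succ_pos 0) ?_
  rw [Real.log_mul hB.ne' (by positivity), Real.log_pow, log_coeffNorm_prime_pow hroot hupp,
    logRadiusSum_eq_log_linRadius hroot hupp hN, log_R_succ 0]
  push_cast
  field_simp
  ring

end PadicLinearization

/-! ### The linearization disk: existence and maximality. -/

namespace PadicLinearization

open Filter Topology

variable {p : ℕ} [Fact p.Prime] {lam : ℂ_[p]}

theorem linRadius_lt_one (hroot : ∀ n : ℕ, 1 ≤ n → lam ^ n ≠ 1) (hupp : ‖1 - lam‖ < 1)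
    (hsq : ‖1 - lam ^ p‖ ≤ ‖1 - lam‖ ^ 2) (hlt : ‖1 - lam ^ p‖ < ‖1 - lam‖) :
    linRadius lam < 1 := by
  have h1 : 1 < coeffNorm lam 1 := by
    simpa using coeffNorm_strictMono hroot hupp hlt zero_lt_one
  have h2 := coeffNorm_mul_linRadius_pow_le hroot hupp hsq 1
  have h3 := linRadius_pos hroot hupp
  rw [pow_one] at h2
  nlinarith

/-- The quadratic map is linearizable on the open disk of radius `linRadius`. -/
theorem isConjugateToRotationOn_ball (hp : 3 ≤ p) (hroot : ∀ n : ℕ, 1 ≤ n → lam ^ n ≠ 1)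
    (hlow : 1 / (p : ℝ) < ‖1 - lam‖) (hupp : ‖1 - lam‖ < 1)
    (hsq : ‖1 - lam ^ p‖ ≤ ‖1 - lam‖ ^ 2) (hlt : ‖1 - lam ^ p‖ < ‖1 - lam‖) :
    IsConjugateToRotationOn (quadraticMap lam) lam (Metric.ball 0 (linRadius lam)) := by
  have hlam := norm_eq_one_of_norm_one_sub_lt hupp
  have hr := linRadius_pos hroot hupp
  have hr1 := linRadius_lt_one hroot hupp hsq hlt
  have hrec := compCoeff_linCoeff hroot (norm_pos_iff.1 (hlam.symm ▸ one_pos))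
  have h0 : linCoeff lam 0 = 0 := by rw [linCoeff]
  have h1 : linCoeff lam 1 = 1 := by rw [linCoeff]
  have hcoeff : ∀ n, ‖linCoeff lam (n + 1)‖ * linRadius lam ^ n ≤ 1 := by
    intro n
    rw [norm_coeff_eq hp hroot hlow hupp hlt h0 hrec n, h1, norm_one, one_mul]
    exact coeffNorm_mul_linRadius_pow_le hroot hupp hsq n
  have hbound : ∀ k, ‖linCoeff lam k‖ * linRadius lam ^ k ≤ linRadius lam := by
    intro k
    rcases k with _ | k
    · rw [h0, norm_zero, zero_mul]; exact hr.le
    · rw [pow_succ, ← mul_assoc]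
      exact mul_le_of_le_one_left hr.le (hcoeff k)
  have hs : ∀ x : ℂ_[p], ‖x‖ < linRadius lam → Summable fun k => linCoeff lam k * x ^ k :=
    fun x hx => (summable_norm_coeff_mul_pow hr hbound hx).of_norm
  refine ⟨fun x hx => ?_, PowerSeries.mk (linCoeff lam), Metric.ball 0 (linRadius lam),
    ⟨_, hr, Or.inl rfl⟩, fun x hx => ?_, ?_, fun x hx => ?_⟩
  · rw [mem_ball_zero_iff] at hx ⊢
    refine (IsUltrametricDist.norm_add_le_max _ _).trans_lt (max_lt ?_ ?_)
    · rwa [norm_mul, hlam, one_mul]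
    · rw [norm_pow, sq]
      exact (mul_le_of_le_one_left (norm_nonneg x) (hx.trans hr1).le).trans_lt hx
  · simpa only [PowerSeries.coeff_mk] using hs x (mem_ball_zero_iff.1 hx)
  · have := bijOn_ball_tsum h0 h1 hr hcoeff hs
    refine this.congr fun x _ => ?_
    simp only [evalSeries, PowerSeries.coeff_mk]
  · rw [mem_ball_zero_iff] at hx
    simp only [evalSeries, PowerSeries.coeff_mk]
    rw [← (hasSum_compCoeff hlam.le hr hbound hx (hx.trans hr1)).tsum_eq, ← tsum_mul_left]
    simp only [hrec, mul_assoc]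

/-- No disk reaching the radius `linRadius` carries a linearization. -/
theorem subset_ball_of_isConjugateToRotationOn (hp : 3 ≤ p)
    (hroot : ∀ n : ℕ, 1 ≤ n → lam ^ n ≠ 1)
    (hlow : 1 / (p : ℝ) < ‖1 - lam‖) (hupp : ‖1 - lam‖ < 1)
    (hlt : ‖1 - lam ^ p‖ < ‖1 - lam‖) {D : Set ℂ_[p]} (hD : IsDisk D)
    (hconj : IsConjugateToRotationOn (quadraticMap lam) lam D) :
    D ⊆ Metric.ball 0 (linRadius lam) := by
  intro x hxD
  rw [mem_ball_zero_iff]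
  by_contra! hx
  have hlam := norm_eq_one_of_norm_one_sub_lt hupp
  have hr := linRadius_pos hroot hupp
  have hx0 : 0 < ‖x‖ := hr.trans_le hx
  have hsub : ∀ y : ℂ_[p], ‖y‖ ≤ ‖x‖ → y ∈ D := by
    obtain ⟨ρ, -, rfl | rfl⟩ := hD <;> intro y hy
    · rw [mem_ball_zero_iff] at hxD ⊢; exact hy.trans_lt hxD
    · rw [mem_closedBall_zero_iff] at hxD ⊢; exact hy.trans hxD
  obtain ⟨-, H, E, -, hconv, hbij, hfun⟩ := hconj
  set h : ℕ → ℂ_[p] := fun k => PowerSeries.coeff k H with hh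
  have hlim : Tendsto (fun k => ‖h k‖ * ‖x‖ ^ k) atTop (𝓝 0) := by
    have := (hconv x hxD).tendsto_atTop_zero.norm
    simpa only [norm_mul, norm_pow, norm_zero] using this
  obtain ⟨C, hC⟩ : ∃ C, ∀ k, ‖h k‖ * ‖x‖ ^ k ≤ C := by
    obtain ⟨C, hC⟩ := hlim.bddAbove_range
    exact ⟨C, fun k => hC ⟨k, rfl⟩⟩
  -- The functional equation is compared coefficientwise only on the disk of radius `min ‖x‖ 1`,
  -- where the rearrangement is valid.
  have hrec : ∀ k, compCoeff lam h k = lam * h k := by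
    refine congrFun (coeff_eq_of_hasSum_eq (F := fun y => lam * evalSeries H y)
      (lt_min hx0 one_pos) (fun y hy => ?_) fun y hy => ?_)
    · rw [← hfun y (hsub y (hy.le.trans (min_le_left _ _)))]
      exact hasSum_compCoeff hlam.le hx0 hC (hy.trans_le (min_le_left _ _))
        (hy.trans_le (min_le_right _ _))
    · have := (hconv y (hsub y (hy.le.trans (min_le_left _ _)))).hasSum.mul_left lam
      exact this.congr_fun fun k => mul_assoc _ _ _
  have h0 : h 0 = 0 := by
    have h2 : compCoeff lam h 0 = h 0 := by simp [compCoeff]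
    have h3 : h 0 * (1 - lam) = 0 := by
      rw [hrec 0] at h2
      linear_combination -h2
    exact (mul_eq_zero.1 h3).resolve_right (norm_pos_iff.1 (norm_one_sub_pos hroot))
  have hnorm := norm_coeff_eq hp hroot hlow hupp hlt h0 hrec
  -- If `h 1 = 0`, the exact norm formula kills every coefficient, and the zero map is not injective
  -- on `D`.
  have h1 : 0 < ‖h 1‖ := by
    rw [norm_pos_iff]
    intro hz
    have hall : ∀ k, h k = 0 := by
      intro k
      rcases k with _ | k
      · exact h0
      · rw [← norm_eq_zero, hnorm, hz, norm_zero, zero_mul]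
    have hev : ∀ y, evalSeries H y = 0 := by
      intro y
      have : ∀ k, PowerSeries.coeff k H * y ^ k = 0 := fun k => by
        rw [show PowerSeries.coeff k H = 0 from hall k, zero_mul]
      simp only [evalSeries, this, tsum_zero]
    have := hbij.injOn hxD (hsub 0 (by simp)) ((hev x).trans (hev 0).symm)
    exact hx0.ne' (by rw [this, norm_zero])
  have hN : Tendsto (fun N : ℕ => p ^ (N + 1) + 1) atTop atTop :=
    tendsto_atTop_mono (fun N => (Nat.lt_pow_self (Fact.out : p.Prime).one_lt).le.trans
      ((Nat.pow_le_pow_right (Fact.out : p.Prime).pos N.le_succ).trans (Nat.le_succ _))) tendsto_id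
  -- This is the lower bound for the terms of index `p ^ (N + 1) + 1`. The index shift between `h`
  -- and `coeffNorm` accounts for the extra factor `linRadius lam`.
  have hpos : 0 < ‖h 1‖ * R p 1 * linRadius lam := mul_pos (mul_pos h1 (R_succ_pos 0)) hr
  obtain ⟨N, hlt', hsN⟩ := (((hlim.comp hN).eventually_lt_const hpos).and
    (eventually_ge_atTop (sIndex lam))).exists
  refine hlt'.not_ge ?_
  rw [Function.comp_apply, hnorm (p ^ (N + 1)),
    ← coeffNorm_mul_linRadius_pow_prime_pow hroot hupp (hsN.trans N.le_succ)]
  have := coeffNorm_pos hroot (p ^ (N + 1))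
  calc _ = ‖h 1‖ * coeffNorm lam (p ^ (N + 1)) * linRadius lam ^ (p ^ (N + 1) + 1) := by
        rw [pow_succ (linRadius lam)]; ring
    _ ≤ _ := by gcongr

end PadicLinearization

theorem theoremB (p : ℕ) [Fact p.Prime] (hp : 3 ≤ p) (lam : ℂ_[p])
    (hroot : ∀ n : ℕ, 1 ≤ n → lam ^ n ≠ 1)
    (hlow : 1 / (p : ℝ) < ‖1 - lam‖) (hupp : ‖1 - lam‖ < 1) :
    PadicLinearization.IsLinearizationDisk (PadicLinearization.quadraticMap lam) lam
      (Metric.ball (0 : ℂ_[p])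
        (‖1 - lam‖ ^ (-(1 / (p : ℝ))) * PadicLinearization.rTilde lam)) := by
  have hsq := PadicLinearization.norm_one_sub_pow_prime_le_sq hp hlow hupp
  have hd := PadicLinearization.norm_one_sub_pos hroot
  have hlt : ‖1 - lam ^ p‖ < ‖1 - lam‖ := by
    rw [sq] at hsq
    exact hsq.trans_lt (mul_lt_of_lt_one_left hd hupp)
  refine ⟨⟨⟨_, PadicLinearization.linRadius_pos hroot hupp, Or.inl rfl⟩, ?_⟩, ?_⟩
  · exact PadicLinearization.isConjugateToRotationOn_ball hp hroot hlow hupp hsq hlt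
  · rintro D ⟨hD, hconj⟩
    exact PadicLinearization.subset_ball_of_isConjugateToRotationOn hp hroot hlow hupp hlt hD hconj
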